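/- Let $\Gamma$ be a group generated by a finite set $S$, and let $|g|$ denote the word length of $g\in\Gamma$ with respect to $S\cup S^{-1}$. Let $\mu$ be a symmetric probability measure on $\Gamma$ (i.e. $\mu(g^{-1})=\mu(g)$ for all $g$) with finite second moment, $\sum_{g\in\Gamma}|g|^2\mu(g)<\infty$, and whose support contains $S$. Suppose that $\Gamma$ acts by isometries, without a global fixed point, on a (nonempty) finite-dimensional complete CAT(0) space $Y$. Then there is a finite-dimensional complete CAT(0) space $Z$ on which $\Gamma$ acts by isometries and a harmonic equivariant map $h:\Gamma\to Z$ with $0<E(h)<\infty$. Here the energy of a map $f:\Gamma\to Z$ is $E(f)=\sum_{g\in\Gamma}d(f(e),f(g))^2\mu(g)\in[0,\infty]$; $f$ is equivariant if $f(g)=g\,f(e)$ for all $g\in\Gamma$; and an equivariant map $h$ is harmonic if $E(h)\le E(f)$ for every equivariant map $f:\Gamma\to Z$. The dimension of a complete CAT(0) space $X$ is the greatest $n$ such that some points $x_0,\dots,x_n\in X$ span a nondegenerate barycentric simplex; the barycentric simplex $\sigma:\Delta_n\to X$ sends $\alpha$ in the standard simplex $\Delta_n$ to the unique minimizer of $y\mapsto\sum_i\alpha_i\,d(x_i,y)^2$,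 and it is degenerate if $\sigma(\Delta_n)=\sigma(\partial\Delta_n)$. $X$ is finite-dimensional if this dimension is finite. -/

import Mathlib

open scoped ENNReal

universe u v

/-- `c`, restricted to `[0, 1]`, is a geodesic from `x` to `y`, parametrized proportionally to
arc length. -/
def IsGeodesicSegment {X : Type*} [MetricSpace X] (c : ℝ → X) (x y : X) : Prop :=
  c 0 = x ∧ c 1 = y ∧
    ∀ s ∈ Set.Icc (0 : ℝ) 1, ∀ t ∈ Set.Icc (0 : ℝ) 1, dist (c s) (c t) = |s - t| * dist x y

/-- A `CAT(0)` space: a (nonempty) geodesic metric space all of whose geodesic triangles are at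
least as thin as their comparison triangles in the Euclidean plane.
The two points to be compared lie on two sides of the triangle; the common vertex of these two
sides is called `x` (two points of one side are trivially at the same distance as their comparison
points). The triangle `a`, `b`, `c` is the comparison triangle, and
`AffineMap.lineMap a b s`, `AffineMap.lineMap a c t` are the comparison points. -/
structure IsCAT0 (X : Type*) [MetricSpace X] : Prop where
  nonempty : Nonempty X
  exists_geodesic : ∀ x y : X, ∃ c : ℝ → X, IsGeodesicSegment c x y
  comparison : ∀ (x y z : X) (c₁ c₂ c₃ : ℝ → X),
    IsGeodesicSegment c₁ x y → IsGeodesicSegment c₂ x z → IsGeodesicSegment c₃ y z →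
    ∀ a b c : EuclideanSpace ℝ (Fin 2),
      dist a b = dist x y → dist a c = dist x z → dist b c = dist y z →
      ∀ s ∈ Set.Icc (0 : ℝ) 1, ∀ t ∈ Set.Icc (0 : ℝ) 1,
        dist (c₁ s) (c₂ t) ≤ dist (AffineMap.lineMap a b s) (AffineMap.lineMap a c t)

/-- `y` is a barycenter of the points `x i` with weights `α i`: it minimizes
`z ↦ ∑ i, α i * d (x i, z) ^ 2`. In a complete `CAT(0)` space there is exactly one. -/
def IsBarycenter {X : Type*} [MetricSpace X] {n : ℕ} (x : Fin (n + 1) → X)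
    (α : Fin (n + 1) → ℝ) (y : X) : Prop :=
  ∀ z : X, ∑ i, α i * dist (x i) y ^ 2 ≤ ∑ i, α i * dist (x i) z ^ 2

/-- The image `σ(A)` of a set `A` of weights under the barycentric simplex `σ` with
vertices `x 0, …, x n`. -/
def barycentricImage {X : Type*} [MetricSpace X] {n : ℕ} (x : Fin (n + 1) → X)
    (A : Set (Fin (n + 1) → ℝ)) : Set X :=
  {y | ∃ α ∈ A, IsBarycenter x α y}

/-- The boundary of the standard simplex: the points with some vanishing coordinate. -/
def stdSimplexBoundary (n : ℕ) : Set (Fin (n + 1) → ℝ) :=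
  {α | α ∈ stdSimplex ℝ (Fin (n + 1)) ∧ ∃ i, α i = 0}

/-- The barycentric simplex `σ` with vertices `x 0, …, x n` is degenerate if `σ(Δ) = σ(∂Δ)`. -/
def IsDegenerateSimplex {X : Type*} [MetricSpace X] {n : ℕ} (x : Fin (n + 1) → X) : Prop :=
  barycentricImage x (stdSimplex ℝ (Fin (n + 1))) = barycentricImage x (stdSimplexBoundary n)

/-- The dimension of a complete `CAT(0)` space: the greatest `n` for which there is a
nondegenerate barycentric simplex with `n + 1` vertices, and `⊤` if there is no greatest one. -/
noncomputable def cat0Dim (X : Type*) [MetricSpace X] : ℕ∞ :=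
  sSup {N : ℕ∞ | ∃ n : ℕ, N = n ∧ ∃ x : Fin (n + 1) → X, ¬ IsDegenerateSimplex x}

/-- A finite-dimensional complete `CAT(0)` space. -/
structure IsFiniteDimCompleteCAT0 (X : Type*) [MetricSpace X] : Prop where
  isCAT0 : IsCAT0 X
  complete : CompleteSpace X
  finiteDim : cat0Dim X < ⊤

/-- The word length of `g` with respect to a generating set `S`: the least length of a word in
the elements of `S` and their inverses that represents `g`. -/
noncomputable def wordLength {Γ : Type*} [Group Γ] (S : Set Γ) (g : Γ) : ℕ :=
  sInf {n | ∃ l : List Γ, l.length = n ∧ (∀ a ∈ l, a ∈ S ∨ a⁻¹ ∈ S) ∧ l.prod = g}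

/-- `μ` has finite second moment: `∑ g, |g| ^ 2 μ(g) < ∞`, with `|g|` the word length. -/
def HasFiniteSecondMoment {Γ : Type*} [Group Γ] (S : Set Γ) (μ : PMF Γ) : Prop :=
  ∑' g, (wordLength S g : ℝ≥0∞) ^ 2 * μ g < ∞

/-- The `μ`-energy `∑ g, d (f e, f g) ^ 2 μ(g)` of a map `f : Γ → X`, with values in `[0, ∞]`. -/
noncomputable def energy {Γ : Type*} [Group Γ] {X : Type*} [MetricSpace X] (μ : PMF Γ)
    (f : Γ → X) : ℝ≥0∞ :=
  ∑' g, edist (f 1) (f g) ^ 2 * μ g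

/-- `f` is equivariant: `f g = g • f e`. -/
def IsEquivariantMap {Γ : Type*} [Group Γ] {X : Type*} [MulAction Γ X] (f : Γ → X) : Prop :=
  ∀ g : Γ, f g = g • f 1

/-- `h` is an equivariant harmonic map: it minimizes the energy among all equivariant maps. -/
def IsHarmonicEquivariantMap {Γ : Type*} [Group Γ] {X : Type*} [MetricSpace X] [MulAction Γ X]
    (μ : PMF Γ) (h : Γ → X) : Prop :=
  IsEquivariantMap h ∧ ∀ f : Γ → X, IsEquivariantMap f → energy μ h ≤ energy μ f

open Filter Topology NNReal

/-! For y in Y let F(y) be the energy of the orbit map of y. Displacements at y are bounded by word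
length times a constant multiple of √F(y), so without a fixed point F cannot tend to zero along a
convergent sequence. Completeness then gives points p_n with F ≥ (1 - 1/(n+1)) F(p_n) on the ball of
radius n√F(p_n) about p_n (`exists_almost_minimizer`).

Rescale Y by 1/√F(p_n) around p_n and pass to the ultralimit. Γ acts there because rescaled
displacements of p_n stay bounded. By dominated convergence (`Ultralimit.tendsto_orbitEnergy`) the
limit of the base points has energy 1 and every point has energy at least 1, so its orbit map is
harmonic.

CAT(0) passes to the limit because Stewart's inequality does. Finite dimension passes because the
boundary of the standard simplex is compact (`Ultralimit.isDegenerateSimplex`). -/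

/-! ### Comparison triangles and Stewart's inequality -/

theorem exists_comparison_triangle {p q r : ℝ} (hp : 0 ≤ p) (hq : 0 ≤ q) (hr : 0 ≤ r)
    (hpq : r ≤ p + q) (hpr : q ≤ p + r) (hqr : p ≤ q + r) :
    ∃ a b c : EuclideanSpace ℝ (Fin 2), dist a b = p ∧ dist a c = q ∧ dist b c = r := by
  rcases hp.eq_or_lt with rfl | hp
  · obtain rfl : q = r := by linarith
    refine ⟨!₂[0, 0], !₂[0, 0], !₂[q, 0], ?_, ?_, ?_⟩ <;>
      simp [EuclideanSpace.dist_eq, Real.dist_eq, Real.sqrt_sq hq]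
  -- Law of cosines: w is the first coordinate of c when a is the origin and b = (p, 0).
  · set w := (p ^ 2 + q ^ 2 - r ^ 2) / (2 * p) with hw
    have hwp : 2 * p * w = p ^ 2 + q ^ 2 - r ^ 2 := by rw [hw]; field_simp
    have h1 : w ≤ q := by
      rw [hw, div_le_iff₀ (by positivity)]; nlinarith [mul_nonneg (sub_nonneg.2 hpr) hr]
    have h2 : -q ≤ w := by
      rw [hw, le_div_iff₀ (by positivity)]; nlinarith
    have hv : 0 ≤ q ^ 2 - w ^ 2 := by nlinarith
    refine ⟨!₂[0, 0], !₂[p, 0], !₂[w, √(q ^ 2 - w ^ 2)], ?_, ?_, ?_⟩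
    · simp [EuclideanSpace.dist_eq, Real.dist_eq, Real.sqrt_sq hp.le]
    · rw [EuclideanSpace.dist_eq, Real.sqrt_eq_iff_mul_self_eq (by positivity) hq]
      simp only [Fin.sum_univ_two, Real.dist_eq, sq_abs]
      simp [Real.sq_sqrt hv]
      ring
    · rw [EuclideanSpace.dist_eq, Real.sqrt_eq_iff_mul_self_eq (by positivity) hr]
      simp only [Fin.sum_univ_two, Real.dist_eq, sq_abs]
      simp [Real.sq_sqrt hv]
      nlinarith

theorem dist_sq_lineMap {V : Type*} [NormedAddCommGroup V] [InnerProductSpace ℝ V]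
    (a b c : V) (t : ℝ) :
    dist (AffineMap.lineMap a b t) c ^ 2
      = (1 - t) * dist a c ^ 2 + t * dist b c ^ 2 - t * (1 - t) * dist a b ^ 2 := by
  have h1 : AffineMap.lineMap a b t - c = (1 - t) • (a - c) + t • (b - c) := by
    rw [AffineMap.lineMap_apply_module]; module
  have h2 : a - b = (a - c) - (b - c) := by abel
  rw [dist_eq_norm, dist_eq_norm, dist_eq_norm, dist_eq_norm, h1, h2]
  generalize a - c = v
  generalize b - c = w
  rw [norm_add_sq_real, norm_sub_sq_real, norm_smul, norm_smul, real_inner_smul_left,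
    real_inner_smul_right, mul_pow, mul_pow, Real.norm_eq_abs, Real.norm_eq_abs, sq_abs, sq_abs]
  ring

section

variable {X : Type*} [MetricSpace X]

theorem IsGeodesicSegment.dist_left {c : ℝ → X} {x y : X} (h : IsGeodesicSegment c x y)
    {t : ℝ} (ht : t ∈ Set.Icc (0 : ℝ) 1) : dist (c t) x = t * dist x y := by
  conv_lhs => rw [← h.1]
  rw [h.2.2 t ht 0 ⟨le_rfl, zero_le_one⟩, sub_zero, abs_of_nonneg ht.1]

theorem IsGeodesicSegment.dist_right {c : ℝ → X} {x y : X} (h : IsGeodesicSegment c x y)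
    {t : ℝ} (ht : t ∈ Set.Icc (0 : ℝ) 1) : dist (c t) y = (1 - t) * dist x y := by
  conv_lhs => rw [← h.2.1]
  rw [h.2.2 t ht 1 ⟨zero_le_one, le_rfl⟩, abs_sub_comm, abs_of_nonneg (by linarith [ht.2])]

/-- Stewart's inequality: the squared distance to a point is `2`-convex along geodesics. -/
def IsStewartSegment (c : ℝ → X) (x y : X) : Prop :=
  ∀ z, ∀ t ∈ Set.Icc (0 : ℝ) 1,
    dist (c t) z ^ 2 ≤ (1 - t) * dist x z ^ 2 + t * dist y z ^ 2 - t * (1 - t) * dist x y ^ 2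

theorem IsCAT0.isStewartSegment (hX : IsCAT0 X) {c : ℝ → X} {x y : X}
    (hc : IsGeodesicSegment c x y) : IsStewartSegment c x y := by
  intro z t ht
  obtain ⟨c₂, hc₂⟩ := hX.exists_geodesic x z
  obtain ⟨c₃, hc₃⟩ := hX.exists_geodesic y z
  obtain ⟨a, b, d, hab, had, hbd⟩ := exists_comparison_triangle (p := dist x y) (q := dist x z)
    (r := dist y z) dist_nonneg dist_nonneg dist_nonneg (dist_triangle_left _ _ _)
    (dist_triangle _ _ _) (dist_triangle_right _ _ _)
  have h := hX.comparison x y z c c₂ c₃ hc hc₂ hc₃ a b d hab had hbd t ht 1 ⟨zero_le_one, le_rfl⟩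
  rw [hc₂.2.1, AffineMap.lineMap_apply_one] at h
  calc dist (c t) z ^ 2 ≤ dist (AffineMap.lineMap a b t) d ^ 2 := by gcongr
    _ = _ := by rw [dist_sq_lineMap, hab, had, hbd]

/-- A geodesic satisfying Stewart's inequality is the only geodesic between its endpoints. -/
theorem IsGeodesicSegment.eq_of_isStewartSegment {c c' : ℝ → X} {x y : X}
    (hS : IsStewartSegment c x y) (hc' : IsGeodesicSegment c' x y) {t : ℝ}
    (ht : t ∈ Set.Icc (0 : ℝ) 1) : c t = c' t := by
  have h := hS (c' t) t ht
  rw [dist_comm x, dist_comm y, hc'.dist_left ht, hc'.dist_right ht] at h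
  have : dist (c t) (c' t) ^ 2 ≤ 0 := by nlinarith
  exact dist_eq_zero.1 (pow_eq_zero_iff two_ne_zero |>.1 (this.antisymm (sq_nonneg _)))

/-- A space in which any two points are joined by a geodesic satisfying Stewart's inequality is
`CAT(0)`. -/
theorem IsCAT0.of_exists_isStewartSegment (hne : Nonempty X)
    (h : ∀ x y : X, ∃ c, IsGeodesicSegment c x y ∧ IsStewartSegment c x y) : IsCAT0 X := by
  have hS : ∀ (x y : X) (c : ℝ → X), IsGeodesicSegment c x y → IsStewartSegment c x y := by
    intro x y c hc z t ht
    obtain ⟨c', -, hS⟩ := h x y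
    rw [← hc.eq_of_isStewartSegment hS ht]
    exact hS z t ht
  refine ⟨hne, fun x y => (h x y).imp fun c hc => hc.1, ?_⟩
  intro x y z c₁ c₂ c₃ h₁ h₂ h₃ a b c hab hac hbc s hs t ht
  refine le_of_sq_le_sq ?_ dist_nonneg
  -- Stewart along `c₁` seen from z, then along `c₂` seen from `c₁ s`; in the plane both are
  -- equalities.
  have e₁ := hS _ _ _ h₁ z s hs
  have e₂ := hS _ _ _ h₂ (c₁ s) t ht
  rw [dist_comm (c₁ s), dist_comm (AffineMap.lineMap a b s), dist_sq_lineMap,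
    dist_comm a (AffineMap.lineMap a b s), dist_comm c (AffineMap.lineMap a b s), dist_sq_lineMap,
    dist_sq_lineMap, dist_self, dist_comm b a, hab, hac, hbc]
  rw [dist_comm x, dist_comm z, h₁.dist_left hs] at e₂
  nlinarith [mul_le_mul_of_nonneg_left e₁ ht.1]

/-! ### Barycenters -/

theorem IsCAT0.exists_midpoint (hX : IsCAT0 X) (x y : X) :
    ∃ m : X, ∀ z, dist z m ^ 2 ≤ (dist z x ^ 2 + dist z y ^ 2) / 2 - dist x y ^ 2 / 4 := by
  obtain ⟨c, hc⟩ := hX.exists_geodesic x y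
  refine ⟨c (1 / 2), fun z => ?_⟩
  have h := hX.isStewartSegment hc z (1 / 2) ⟨by norm_num, by norm_num⟩
  rw [dist_comm z, dist_comm z, dist_comm z]
  linarith

/-- Uniform convexity of the function minimized by barycenters: it gives their uniqueness and makes
minimizing sequences Cauchy. -/
theorem IsCAT0.exists_sum_midpoint_le (hX : IsCAT0 X) {n : ℕ} (x : Fin (n + 1) → X)
    {α : Fin (n + 1) → ℝ} (hα : α ∈ stdSimplex ℝ (Fin (n + 1))) (y z : X) :
    ∃ m : X, ∑ i, α i * dist (x i) m ^ 2 ≤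
      (∑ i, α i * dist (x i) y ^ 2 + ∑ i, α i * dist (x i) z ^ 2) / 2 - dist y z ^ 2 / 4 := by
  obtain ⟨m, hm⟩ := hX.exists_midpoint y z
  refine ⟨m, ?_⟩
  calc ∑ i, α i * dist (x i) m ^ 2
      ≤ ∑ i, α i * ((dist (x i) y ^ 2 + dist (x i) z ^ 2) / 2 - dist y z ^ 2 / 4) :=
        Finset.sum_le_sum fun i _ => mul_le_mul_of_nonneg_left (hm _) (hα.1 i)
    _ = (∑ i, α i * dist (x i) y ^ 2 + ∑ i, α i * dist (x i) z ^ 2) / 2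
          - (∑ i, α i) * (dist y z ^ 2 / 4) := by
        rw [Finset.sum_mul, ← Finset.sum_add_distrib, Finset.sum_div, ← Finset.sum_sub_distrib]
        exact Finset.sum_congr rfl fun i _ => by ring
    _ = _ := by rw [hα.2, one_mul]

theorem IsCAT0.isBarycenter_unique (hX : IsCAT0 X) {n : ℕ} {x : Fin (n + 1) → X}
    {α : Fin (n + 1) → ℝ} (hα : α ∈ stdSimplex ℝ (Fin (n + 1))) {y z : X}
    (hy : IsBarycenter x α y) (hz : IsBarycenter x α z) : y = z := by
  obtain ⟨m, hm⟩ := hX.exists_sum_midpoint_le x hα y z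
  have h₁ := hy m
  have h₂ := hz m
  have : dist y z ^ 2 ≤ 0 := by linarith
  exact dist_eq_zero.1 (pow_eq_zero_iff two_ne_zero |>.1 (this.antisymm (sq_nonneg _)))

theorem IsCAT0.exists_isBarycenter [CompleteSpace X] (hX : IsCAT0 X) {n : ℕ}
    (x : Fin (n + 1) → X) {α : Fin (n + 1) → ℝ} (hα : α ∈ stdSimplex ℝ (Fin (n + 1))) :
    ∃ y, IsBarycenter x α y := by
  set G : X → ℝ := fun z => ∑ i, α i * dist (x i) z ^ 2 with hG
  have hbdd : BddBelow (Set.range G) := by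
    refine ⟨0, ?_⟩
    rintro _ ⟨z, rfl⟩
    exact Finset.sum_nonneg fun i _ => mul_nonneg (hα.1 i) (sq_nonneg _)
  have := hX.nonempty
  set I := ⨅ z, G z with hI
  have hIle : ∀ z, I ≤ G z := fun z => ciInf_le hbdd z
  have hex : ∀ k : ℕ, ∃ z, G z < I + (1 / 2 : ℝ) ^ k := fun k =>
    exists_lt_of_ciInf_lt (lt_add_of_pos_right _ (by positivity))
  choose z hz using hex
  have hdist : ∀ N k l, N ≤ k → N ≤ l → dist (z k) (z l) ^ 2 ≤ 4 * (1 / 2 : ℝ) ^ N := by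
    intro N k l hk hl
    obtain ⟨m, hm⟩ := hX.exists_sum_midpoint_le x hα (z k) (z l)
    have h₁ : I ≤ (G (z k) + G (z l)) / 2 - dist (z k) (z l) ^ 2 / 4 := (hIle m).trans hm
    have h₂ : (1 / 2 : ℝ) ^ k ≤ (1 / 2) ^ N :=
      pow_le_pow_of_le_one (by norm_num) (by norm_num) hk
    have h₃ : (1 / 2 : ℝ) ^ l ≤ (1 / 2) ^ N :=
      pow_le_pow_of_le_one (by norm_num) (by norm_num) hl
    linarith [hz k, hz l]
  have hlim : Filter.Tendsto (fun N : ℕ => (1 / 2 : ℝ) ^ N) Filter.atTop (nhds 0) :=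
    tendsto_pow_atTop_nhds_zero_of_lt_one (by norm_num) (by norm_num)
  have hcau : CauchySeq z := by
    refine cauchySeq_of_le_tendsto_0 (fun N => √(4 * (1 / 2 : ℝ) ^ N)) ?_ ?_
    · intro k l N hk hl
      exact Real.le_sqrt_of_sq_le (hdist N k l hk hl)
    · have h := (Real.continuous_sqrt.tendsto _).comp (hlim.const_mul 4)
      rwa [mul_zero, Real.sqrt_zero] at h
  obtain ⟨y, hy⟩ := cauchySeq_tendsto_of_complete hcau
  have hGc : Continuous G := by fun_prop
  refine ⟨y, fun w => le_trans (?_ : G y ≤ I) (hIle w)⟩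
  refine le_of_tendsto_of_tendsto' ((hGc.tendsto y).comp hy) ?_ fun k => (hz k).le
  simpa using hlim.const_add I

/-- A barycenter is not much further from a given point than the vertices are. -/
theorem IsBarycenter.dist_le {n : ℕ} {x : Fin (n + 1) → X} {α : Fin (n + 1) → ℝ}
    (hα : α ∈ stdSimplex ℝ (Fin (n + 1))) {b : X} (hb : IsBarycenter x α b) {p : X} {R : ℝ}
    (hR : ∀ i, dist (x i) p ≤ R) : dist b p ≤ 2 * R := by
  have hR0 : 0 ≤ R := dist_nonneg.trans (hR 0)
  have h₁ : ∑ i, α i * dist (x i) p ^ 2 ≤ R ^ 2 := by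
    calc ∑ i, α i * dist (x i) p ^ 2 ≤ ∑ i, α i * R ^ 2 :=
          Finset.sum_le_sum fun i _ => mul_le_mul_of_nonneg_left
            (pow_le_pow_left₀ dist_nonneg (hR i) 2) (hα.1 i)
      _ = R ^ 2 := by rw [← Finset.sum_mul, hα.2, one_mul]
  have h₂ : dist b p ^ 2 ≤
      2 * ∑ i, α i * dist (x i) b ^ 2 + 2 * ∑ i, α i * dist (x i) p ^ 2 := by
    calc dist b p ^ 2 = ∑ i, α i * dist b p ^ 2 := by rw [← Finset.sum_mul, hα.2, one_mul]
      _ ≤ ∑ i, α i * (2 * dist (x i) b ^ 2 + 2 * dist (x i) p ^ 2) := by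
          refine Finset.sum_le_sum fun i _ => mul_le_mul_of_nonneg_left ?_ (hα.1 i)
          have := pow_le_pow_left₀ dist_nonneg (dist_triangle_left b p (x i)) 2
          nlinarith [sq_nonneg (dist (x i) b - dist (x i) p)]
      _ = _ := by
          rw [Finset.mul_sum, Finset.mul_sum, ← Finset.sum_add_distrib]
          exact Finset.sum_congr rfl fun i _ => by ring
  refine le_of_sq_le_sq ?_ (by positivity)
  nlinarith [hb p]

end

/-! ### Dimension and degenerate simplices -/

theorem cat0Dim_lt_top_iff {X : Type*} [MetricSpace X] :
    cat0Dim X < ⊤ ↔ ∃ m : ℕ, ∀ n, m < n → ∀ x : Fin (n + 1) → X, IsDegenerateSimplex x := by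
  constructor
  · intro h
    obtain ⟨m, hm⟩ := ENat.ne_top_iff_exists.1 h.ne
    refine ⟨m, fun n hn x => ?_⟩
    by_contra hx
    have : (n : ℕ∞) ≤ cat0Dim X := le_sSup ⟨n, rfl, x, hx⟩
    rw [← hm, Nat.cast_le] at this
    omega
  · rintro ⟨m, hm⟩
    refine lt_of_le_of_lt (sSup_le ?_) (ENat.natCast_lt_top m)
    rintro _ ⟨n, rfl, x, hx⟩
    rw [Nat.cast_le]
    by_contra hn
    exact hx (hm n (not_le.1 hn) x)

theorem isClosed_stdSimplexBoundary (n : ℕ) : IsClosed (stdSimplexBoundary n) := by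
  have : stdSimplexBoundary n = stdSimplex ℝ (Fin (n + 1)) ∩ ⋃ i, {α | α i = 0} := by
    ext α
    simp [stdSimplexBoundary]
  rw [this]
  exact (isClosed_stdSimplex ℝ (Fin (n + 1))).inter
    (isClosed_iUnion_of_finite fun i => isClosed_eq (continuous_apply i) continuous_const)

theorem isCompact_stdSimplexBoundary (n : ℕ) : IsCompact (stdSimplexBoundary n) :=
  (isCompact_stdSimplex ℝ (Fin (n + 1))).of_isClosed_subset (isClosed_stdSimplexBoundary n)
    fun _ h => h.1

theorem isDegenerateSimplex_iff {X : Type*} [MetricSpace X] {n : ℕ} {x : Fin (n + 1) → X} :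
    IsDegenerateSimplex x ↔ ∀ α ∈ stdSimplex ℝ (Fin (n + 1)), ∀ y, IsBarycenter x α y →
      ∃ β ∈ stdSimplexBoundary n, IsBarycenter x β y := by
  constructor
  · intro h α hα y hy
    exact (h.subset ⟨α, hα, hy⟩ : y ∈ barycentricImage x (stdSimplexBoundary n))
  · intro h
    refine Set.Subset.antisymm ?_ ?_
    · rintro y ⟨α, hα, hy⟩
      exact h α hα y hy
    · rintro y ⟨α, hα, hy⟩
      exact ⟨α, hα.1, hy⟩

/-! ### Ultralimits of rescaled pointed spaces -/

section Ultralimit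

variable {X : Type*} [MetricSpace X]

/-- Sequences in `X` that stay at bounded distance from the base points `p n` when the metric is
rescaled by the factors `s n`. -/
def BoundedSequence (p : ℕ → X) (s : ℕ → ℝ≥0) : Type _ :=
  {x : ℕ → X // ∃ C : ℝ, ∀ n, s n * dist (x n) (p n) ≤ C}

namespace BoundedSequence

variable {p : ℕ → X} {s : ℕ → ℝ≥0}

theorem exists_bound (x y : BoundedSequence p s) :
    ∃ C : ℝ, ∀ n, s n * dist (x.1 n) (y.1 n) ≤ C := by
  obtain ⟨C, hC⟩ := x.2
  obtain ⟨D, hD⟩ := y.2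
  refine ⟨C + D, fun n => ?_⟩
  calc (s n : ℝ) * dist (x.1 n) (y.1 n) ≤ s n * (dist (x.1 n) (p n) + dist (y.1 n) (p n)) := by
        gcongr
        exact dist_triangle_right _ _ _
    _ ≤ C + D := by rw [mul_add]; exact add_le_add (hC n) (hD n)

/-- The sequences at bounded rescaled distance from a bounded sequence are bounded. -/
def ofBound (x : BoundedSequence p s) (y : ℕ → X) (h : ∃ C : ℝ, ∀ n, s n * dist (y n) (x.1 n) ≤ C) :
    BoundedSequence p s :=
  ⟨y, by
    obtain ⟨C, hC⟩ := h
    obtain ⟨D, hD⟩ := x.2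
    refine ⟨C + D, fun n => ?_⟩
    calc (s n : ℝ) * dist (y n) (p n) ≤ s n * (dist (y n) (x.1 n) + dist (x.1 n) (p n)) := by
          gcongr
          exact dist_triangle _ _ _
      _ ≤ C + D := by rw [mul_add]; exact add_le_add (hC n) (hD n)⟩

noncomputable instance : Dist (BoundedSequence p s) :=
  ⟨fun x y => limUnder (hyperfilter ℕ : Filter ℕ) fun n => (s n : ℝ) * dist (x.1 n) (y.1 n)⟩

/-- Bounded real sequences converge along an ultrafilter, so the default value of `limUnder` never
intervenes. -/
theorem tendsto_dist (x y : BoundedSequence p s) :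
    Tendsto (fun n => (s n : ℝ) * dist (x.1 n) (y.1 n)) (hyperfilter ℕ) (𝓝 (dist x y)) := by
  obtain ⟨C, hC⟩ := exists_bound x y
  have hmem : ∀ n, (s n : ℝ) * dist (x.1 n) (y.1 n) ∈ Set.Icc 0 C := fun n =>
    ⟨by positivity, hC n⟩
  obtain ⟨L, -, hL⟩ := (isCompact_Icc (a := (0 : ℝ)) (b := C)).ultrafilter_le_nhds
    ((hyperfilter ℕ).map fun n => (s n : ℝ) * dist (x.1 n) (y.1 n))
    (le_principal_iff.2 (mem_map.2 (Eventually.of_forall hmem)))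
  exact tendsto_nhds_limUnder ⟨L, hL⟩

noncomputable instance : PseudoMetricSpace (BoundedSequence p s) where
  dist_self x := by
    refine tendsto_nhds_unique (tendsto_dist x x) ?_
    simp
  dist_comm x y := by
    refine tendsto_nhds_unique (tendsto_dist x y) ?_
    simpa only [dist_comm] using tendsto_dist y x
  dist_triangle x y z := by
    refine le_of_tendsto_of_tendsto' (tendsto_dist x z)
      ((tendsto_dist x y).add (tendsto_dist y z)) fun n => ?_
    rw [← mul_add]
    gcongr
    exact dist_triangle _ _ _

theorem dist_le_of_eventually {x y : BoundedSequence p s} {C : ℝ}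
    (h : ∀ᶠ n in (hyperfilter ℕ : Filter ℕ), (s n : ℝ) * dist (x.1 n) (y.1 n) ≤ C) :
    dist x y ≤ C :=
  le_of_tendsto (tendsto_dist x y) h

instance : CompleteSpace (BoundedSequence p s) := by
  refine Metric.complete_of_convergent_controlled_sequences (fun N => (1 / 2 : ℝ) ^ N)
    (fun N => by positivity) fun u hu => ?_
  set A : ℕ → ℕ → Prop := fun n j =>
    ∀ i < j, (s n : ℝ) * dist ((u i).1 n) ((u (i + 1)).1 n) < (1 / 2) ^ i with hA
  have hAev : ∀ j, ∀ᶠ n in (hyperfilter ℕ : Filter ℕ), A n j := by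
    intro j
    refine (Set.finite_lt_nat j).eventually_all.2 fun i _ => ?_
    exact (tendsto_dist (u i) (u (i + 1))).eventually_lt_const (hu i i (i + 1) le_rfl (by omega))
  classical
  -- Diagonal argument: coordinate n of the limit comes from the last u j, j ≤ n, up to which the
  -- estimates hold at n. `A n 0` is vacuous.
  set k : ℕ → ℕ := fun n => Nat.findGreatest (A n) n with hk
  have hAk : ∀ n, A n (k n) := fun n =>
    Nat.findGreatest_spec (P := A n) (Nat.zero_le n) fun i hi => absurd hi (Nat.not_lt_zero i)
  have hbound : ∀ n j m, j ≤ m → m ≤ k n →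
      (s n : ℝ) * dist ((u m).1 n) ((u j).1 n) ≤ 2 * (1 / 2) ^ j - 2 * (1 / 2) ^ m := by
    intro n j m hjm
    induction m, hjm using Nat.le_induction with
    | base => intro _; simp
    | succ m hjm ih =>
      intro hm
      have h₁ := ih (by omega)
      have h₂ := hAk n m (by omega)
      have h₃ : (s n : ℝ) * dist ((u (m + 1)).1 n) ((u j).1 n) ≤
          s n * (dist ((u m).1 n) ((u (m + 1)).1 n) + dist ((u m).1 n) ((u j).1 n)) := by
        gcongr
        exact dist_triangle_left _ _ _
      rw [pow_succ]
      linarith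
  have hbound' : ∀ n j, j ≤ k n →
      (s n : ℝ) * dist ((u (k n)).1 n) ((u j).1 n) ≤ 2 * (1 / 2) ^ j := by
    intro n j hj
    have h : (0 : ℝ) < (1 / 2) ^ k n := by positivity
    linarith [hbound n j (k n) hj le_rfl]
  refine ⟨ofBound (u 0) (fun n => (u (k n)).1 n) ⟨_, fun n => hbound' n 0 (Nat.zero_le _)⟩, ?_⟩
  rw [tendsto_iff_dist_tendsto_zero]
  refine squeeze_zero (g := fun j : ℕ => 2 * (1 / 2 : ℝ) ^ j) (fun _ => dist_nonneg) (fun j => ?_) ?_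
  · rw [dist_comm]
    refine dist_le_of_eventually ?_
    -- Nonprincipality of the ultrafilter is what makes `k n` exceed every j.
    have hge : ∀ᶠ n in (hyperfilter ℕ : Filter ℕ), j ≤ n :=
      Nat.hyperfilter_le_atTop (eventually_ge_atTop j)
    filter_upwards [hAev j, hge] with n hn hjn
    exact hbound' n j (Nat.le_findGreatest hjn hn)
  · simpa using (tendsto_pow_atTop_nhds_zero_of_lt_one (r := (1 / 2 : ℝ)) (by norm_num)
      (by norm_num)).const_mul 2

/-- The action of a group is bounded along the rescaled base points. -/
class IsBoundedAction (Γ : Type*) [SMul Γ X] (p : ℕ → X) (s : ℕ → ℝ≥0) : Prop where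
  exists_bound : ∀ g : Γ, ∃ C : ℝ, ∀ n, s n * dist (g • p n) (p n) ≤ C

variable {Γ : Type*} [Group Γ] [MulAction Γ X] [IsIsometricSMul Γ X] [IsBoundedAction Γ p s]

instance : SMul Γ (BoundedSequence p s) where
  smul g x := ⟨fun n => g • x.1 n, by
    obtain ⟨C, hC⟩ := x.2
    obtain ⟨D, hD⟩ := IsBoundedAction.exists_bound (p := p) (s := s) g
    refine ⟨C + D, fun n => ?_⟩
    calc (s n : ℝ) * dist (g • x.1 n) (p n)
        ≤ s n * (dist (g • x.1 n) (g • p n) + dist (g • p n) (p n)) := by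
          gcongr
          exact dist_triangle _ _ _
      _ ≤ C + D := by rw [mul_add, dist_smul]; exact add_le_add (hC n) (hD n)⟩

theorem smul_apply (g : Γ) (x : BoundedSequence p s) (n : ℕ) : (g • x).1 n = g • x.1 n := rfl

instance : MulAction Γ (BoundedSequence p s) where
  one_smul x := Subtype.ext (funext fun n => one_smul Γ (x.1 n))
  mul_smul g h x := Subtype.ext (funext fun n => mul_smul g h (x.1 n))

instance : IsIsometricSMul Γ (BoundedSequence p s) where
  isometry_smul g := Isometry.of_dist_eq fun x y => by
    refine tendsto_nhds_unique (tendsto_dist (g • x) (g • y)) ?_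
    simpa only [smul_apply, dist_smul] using tendsto_dist x y

end BoundedSequence

instance {M X : Type*} [PseudoMetricSpace X] [SMul M X] [IsIsometricSMul M X] :
    IsIsometricSMul M (SeparationQuotient X) where
  isometry_smul g := Isometry.of_dist_eq <| SeparationQuotient.surjective_mk.forall₂.2
    fun x y => by
      rw [← SeparationQuotient.mk_smul, ← SeparationQuotient.mk_smul, SeparationQuotient.dist_mk,
        SeparationQuotient.dist_mk, dist_smul]

/-- The ultralimit of the rescaled pointed spaces `(s n • X, p n)`. -/
abbrev Ultralimit (p : ℕ → X) (s : ℕ → ℝ≥0) : Type _ :=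
  SeparationQuotient (BoundedSequence p s)

namespace Ultralimit

variable {p : ℕ → X} {s : ℕ → ℝ≥0}

open BoundedSequence SeparationQuotient

/-- The point of the ultralimit represented by the base points. -/
def base (p : ℕ → X) (s : ℕ → ℝ≥0) : BoundedSequence p s := ⟨p, 0, by simp⟩

/-- Coordinatewise geodesics converge to geodesics, and Stewart's inequality is a closed condition.
The criterion needs only one such geodesic per pair. -/
theorem isCAT0 (hX : IsCAT0 X) : IsCAT0 (Ultralimit p s) := by
  refine IsCAT0.of_exists_isStewartSegment ⟨mk (base p s)⟩
    (surjective_mk.forall₂.2 fun x y => ?_)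
  choose c hc using fun n => hX.exists_geodesic (x.1 n) (y.1 n)
  -- Clamping to [0, 1] keeps the sequences bounded for every real t.
  have hproj : ∀ t : ℝ, (Set.projIcc (0 : ℝ) 1 zero_le_one t : ℝ) ∈ Set.Icc (0 : ℝ) 1 := fun t =>
    (Set.projIcc (0 : ℝ) 1 zero_le_one t).2
  have hbd : ∀ t : ℝ, ∃ C : ℝ, ∀ n,
      s n * dist (c n (Set.projIcc (0 : ℝ) 1 zero_le_one t)) (x.1 n) ≤ C := by
    intro t
    obtain ⟨C, hC⟩ := exists_bound x y
    refine ⟨C, fun n => le_trans ?_ (hC n)⟩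
    rw [(hc n).dist_left (hproj t)]
    gcongr
    exact mul_le_of_le_one_left dist_nonneg (hproj t).2
  set γ : ℝ → BoundedSequence p s := fun t => ofBound x _ (hbd t) with hγ
  have hγt : ∀ t ∈ Set.Icc (0 : ℝ) 1, ∀ n, (γ t).1 n = c n t := by
    intro t ht n
    change c n (Set.projIcc (0 : ℝ) 1 zero_le_one t) = c n t
    rw [Set.projIcc_of_mem _ ht]
  refine ⟨fun t => mk (γ t), ⟨?_, ?_, ?_⟩, ?_⟩
  · exact congrArg mk (Subtype.ext (funext fun n => by rw [hγt 0 ⟨le_rfl, zero_le_one⟩, (hc n).1]) : γ 0 = x)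
  · exact congrArg mk (Subtype.ext (funext fun n => by rw [hγt 1 ⟨zero_le_one, le_rfl⟩, (hc n).2.1]) : γ 1 = y)
  · intro a ha b hb
    rw [dist_mk, dist_mk]
    refine tendsto_nhds_unique (tendsto_dist _ _) ?_
    refine ((tendsto_dist x y).const_mul |a - b|).congr fun n => ?_
    rw [hγt a ha, hγt b hb, (hc n).2.2 a ha b hb]
    ring
  · refine surjective_mk.forall.2 fun z t ht => ?_
    simp only [dist_mk]
    refine le_of_tendsto_of_tendsto' ((tendsto_dist (γ t) z).pow 2)
      (((((tendsto_dist x z).pow 2).const_mul (1 - t)).add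
        (((tendsto_dist y z).pow 2).const_mul t)).sub
        (((tendsto_dist x y).pow 2).const_mul (t * (1 - t)))) fun n => ?_
    rw [hγt t ht]
    have := hX.isStewartSegment (hc n) (z.1 n) t ht
    calc (s n * dist (c n t) (z.1 n)) ^ 2 = (s n : ℝ) ^ 2 * dist (c n t) (z.1 n) ^ 2 := mul_pow _ _ _
      _ ≤ _ := mul_le_mul_of_nonneg_left this (by positivity)
      _ = _ := by ring

/-- An ultralimit of barycenters is a barycenter. -/
theorem isBarycenter_of_tendsto {m : ℕ} {x : Fin (m + 1) → BoundedSequence p s}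
    {β : ℕ → Fin (m + 1) → ℝ} {α : Fin (m + 1) → ℝ}
    (hβ : Tendsto β (hyperfilter ℕ) (𝓝 α)) {b : BoundedSequence p s}
    (hb : ∀ n, IsBarycenter (fun i => (x i).1 n) (β n) (b.1 n)) :
    IsBarycenter (fun i => (mk (x i) : Ultralimit p s)) α (mk b) := by
  have hlim : ∀ z : BoundedSequence p s,
      Tendsto (fun n => ∑ i, β n i * (s n * dist ((x i).1 n) (z.1 n)) ^ 2) (hyperfilter ℕ)
        (𝓝 (∑ i, α i * dist (x i) z ^ 2)) := fun z =>
    tendsto_finsetSum _ fun i _ => (((continuous_apply i).tendsto α).comp hβ).mul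
      ((tendsto_dist (x i) z).pow 2)
  refine surjective_mk.forall.2 fun z => ?_
  simp only [dist_mk]
  refine le_of_tendsto_of_tendsto' (hlim b) (hlim z) fun n => ?_
  have h : ∀ w : X, ∑ i, β n i * (s n * dist ((x i).1 n) w) ^ 2
      = (s n : ℝ) ^ 2 * ∑ i, β n i * dist ((x i).1 n) w ^ 2 := fun w => by
    rw [Finset.mul_sum]
    exact Finset.sum_congr rfl fun i _ => by ring
  rw [h, h]
  exact mul_le_mul_of_nonneg_left (hb n _) (by positivity)

/-- In each coordinate the barycenter for α is also one for boundary weights; these converge along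
the ultrafilter by compactness, and barycenters pass to the limit. -/
theorem isDegenerateSimplex [CompleteSpace X] (hX : IsCAT0 X) {m : ℕ}
    (h : ∀ x : Fin (m + 1) → X, IsDegenerateSimplex x) (x : Fin (m + 1) → Ultralimit p s) :
    IsDegenerateSimplex x := by
  obtain ⟨x, rfl⟩ : ∃ x' : Fin (m + 1) → BoundedSequence p s, (fun i => mk (x' i)) = x := by
    choose x' hx' using fun i => surjective_mk (x i)
    exact ⟨x', funext hx'⟩
  rw [isDegenerateSimplex_iff]
  intro α hα y hy
  choose b hb using fun n => hX.exists_isBarycenter (fun i => (x i).1 n) hα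
  choose β hβ hbβ using fun n => isDegenerateSimplex_iff.1 (h fun i => (x i).1 n) α hα (b n) (hb n)
  choose C hC using fun i => (x i).2
  have hbd : ∃ D : ℝ, ∀ n, s n * dist (b n) (p n) ≤ D := by
    refine ⟨2 * ∑ i, |C i|, fun n => ?_⟩
    rcases (s n).2.eq_or_lt with h0 | h0
    · have h0 : (s n : ℝ) = 0 := h0.symm
      rw [h0, zero_mul]
      positivity
    · have hs : (0 : ℝ) < s n := h0
      rw [mul_comm, ← le_div_iff₀ hs, mul_div_assoc]
      refine (hb n).dist_le hα fun i => ?_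
      rw [le_div_iff₀ hs, mul_comm]
      exact (hC i n).trans ((le_abs_self _).trans
        (Finset.single_le_sum (f := fun i => |C i|) (fun _ _ => abs_nonneg _) (Finset.mem_univ i)))
  obtain ⟨β', hβ', hlim⟩ := (isCompact_stdSimplexBoundary m).ultrafilter_le_nhds
    ((hyperfilter ℕ).map β) (le_principal_iff.2 (mem_map.2 (Eventually.of_forall hβ)))
  have h₁ := isBarycenter_of_tendsto (b := ⟨b, hbd⟩) (tendsto_const_nhds (x := α)) hb
  have h₂ := isBarycenter_of_tendsto (b := ⟨b, hbd⟩) (β := β) hlim hbβ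
  rw [(isCAT0 hX).isBarycenter_unique hα hy h₁]
  exact ⟨β', hβ', h₂⟩

theorem isFiniteDimCompleteCAT0 (hX : IsFiniteDimCompleteCAT0 X) :
    IsFiniteDimCompleteCAT0 (Ultralimit p s) := by
  have := hX.complete
  refine ⟨isCAT0 hX.isCAT0, inferInstance, cat0Dim_lt_top_iff.2 ?_⟩
  obtain ⟨m, hm⟩ := cat0Dim_lt_top_iff.1 hX.finiteDim
  exact ⟨m, fun n hn => isDegenerateSimplex hX.isCAT0 (hm n hn)⟩

end Ultralimit

end Ultralimit

/-! ### Word length and the energy of orbit maps -/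

section Energy

variable {Γ : Type*} [Group Γ] {S : Set Γ} {μ : PMF Γ}

theorem exists_list_length_eq_wordLength (hS : Subgroup.closure S = ⊤) (g : Γ) :
    ∃ l : List Γ, l.length = wordLength S g ∧ (∀ a ∈ l, a ∈ S ∨ a⁻¹ ∈ S) ∧ l.prod = g := by
  have hne : {n | ∃ l : List Γ, l.length = n ∧ (∀ a ∈ l, a ∈ S ∨ a⁻¹ ∈ S) ∧ l.prod = g}.Nonempty := by
    have hg : g ∈ (Subgroup.closure S).toSubmonoid := hS ▸ Subgroup.mem_top g
    rw [Subgroup.closure_toSubmonoid] at hg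
    obtain ⟨l, hl, hg⟩ := Submonoid.exists_list_of_mem_closure hg
    exact ⟨_, l, rfl, hl, hg⟩
  exact Nat.sInf_mem hne

theorem dist_smul_le_wordLength_mul {X : Type*} [PseudoMetricSpace X] [MulAction Γ X]
    [IsIsometricSMul Γ X] (hS : Subgroup.closure S = ⊤) {y : X} {M : ℝ}
    (hM : ∀ a ∈ S, dist y (a • y) ≤ M) (g : Γ) : dist y (g • y) ≤ wordLength S g * M := by
  obtain ⟨l, hl, hlS, rfl⟩ := exists_list_length_eq_wordLength hS g
  rw [← hl]
  clear hl
  induction l with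
  | nil => simp
  | cons a l ih =>
    have ha : dist y (a • y) ≤ M := by
      rcases hlS a (by simp) with h | h
      · exact hM a h
      · have := hM _ h
        rwa [← dist_smul a, smul_inv_smul, dist_comm] at this
    have ih := ih fun b hb => hlS b (List.mem_cons_of_mem a hb)
    calc dist y ((a :: l).prod • y) ≤ dist y (a • y) + dist (a • y) (a • l.prod • y) := by
          rw [List.prod_cons, mul_smul]
          exact dist_triangle _ _ _
      _ ≤ M + l.length * M := by rw [dist_smul]; exact add_le_add ha ih
      _ = _ := by push_cast [List.length_cons]; ring

theorem HasFiniteSecondMoment.summable (hμ : HasFiniteSecondMoment S μ) :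
    Summable fun g => (wordLength S g : ℝ) ^ 2 * (μ g).toReal := by
  simpa using ENNReal.summable_toReal hμ.ne

theorem PMF.summable_toReal {α : Type*} (μ : PMF α) : Summable fun a => (μ a).toReal :=
  ENNReal.summable_toReal μ.tsum_coe_ne_top

/-- The energy of the orbit map `g ↦ g • y`, as a real number. -/
noncomputable def orbitEnergy {X : Type*} [PseudoMetricSpace X] [MulAction Γ X] (μ : PMF Γ)
    (y : X) : ℝ :=
  ∑' g : Γ, dist y (g • y) ^ 2 * (μ g).toReal

section

variable {X : Type*} [PseudoMetricSpace X] [MulAction Γ X]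

theorem orbitEnergy_nonneg (y : X) : 0 ≤ orbitEnergy μ y :=
  tsum_nonneg fun _ => mul_nonneg (sq_nonneg _) ENNReal.toReal_nonneg

variable [IsIsometricSMul Γ X]

theorem summable_orbitEnergy (hSfin : S.Finite) (hS : Subgroup.closure S = ⊤)
    (hμ : HasFiniteSecondMoment S μ) (y : X) :
    Summable fun g : Γ => dist y (g • y) ^ 2 * (μ g).toReal := by
  obtain ⟨M, hM⟩ := (hSfin.image fun a => dist y (a • y)).bddAbove
  have hM' : ∀ a ∈ S, dist y (a • y) ≤ M := fun a ha => hM ⟨a, ha, rfl⟩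
  refine Summable.of_nonneg_of_le (fun g => mul_nonneg (sq_nonneg _) ENNReal.toReal_nonneg)
    (fun g => ?_) (hμ.summable.mul_left (M ^ 2))
  calc dist y (g • y) ^ 2 * (μ g).toReal ≤ (wordLength S g * M) ^ 2 * (μ g).toReal := by
        gcongr
        exact dist_smul_le_wordLength_mul hS hM' g
    _ = _ := by ring

/-- The displacement of a point is controlled by the energy of its orbit map. -/
theorem exists_dist_smul_le_sqrt_orbitEnergy (hSfin : S.Finite) (hS : Subgroup.closure S = ⊤)
    (hμ : HasFiniteSecondMoment S μ) (hsupp : S ⊆ μ.support) :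
    ∃ C : ℝ, ∀ (y : X) (g : Γ),
      dist y (g • y) ≤ wordLength S g * (C * √(orbitEnergy μ y)) := by
  -- The term of a ∈ S alone gives d(y, ay) ≤ √(F(y)/μ(a)), with μ(a) > 0.
  obtain ⟨C, hC⟩ := (hSfin.image fun a => 1 / √(μ a).toReal).bddAbove
  refine ⟨C, fun y => dist_smul_le_wordLength_mul hS fun a ha => ?_⟩
  have hpos : 0 < √(μ a).toReal := Real.sqrt_pos.2
    (ENNReal.toReal_pos ((PMF.mem_support_iff _ _).1 (hsupp ha)) (PMF.apply_ne_top _ _))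
  have h₁ : dist y (a • y) ^ 2 * (μ a).toReal ≤ orbitEnergy μ y :=
    (summable_orbitEnergy hSfin hS hμ y).le_tsum a
      fun g _ => mul_nonneg (sq_nonneg _) ENNReal.toReal_nonneg
  have h₂ : dist y (a • y) * √(μ a).toReal ≤ √(orbitEnergy μ y) := by
    refine Real.le_sqrt_of_sq_le ?_
    rwa [mul_pow, Real.sq_sqrt ENNReal.toReal_nonneg]
  calc dist y (a • y) ≤ 1 / √(μ a).toReal * √(orbitEnergy μ y) := by
        rwa [one_div, inv_mul_eq_div, le_div_iff₀ hpos]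
    _ ≤ C * √(orbitEnergy μ y) := by
        gcongr
        exact hC ⟨a, ha, rfl⟩

end

theorem energy_eq_ofReal_orbitEnergy {X : Type*} [MetricSpace X] [MulAction Γ X]
    [IsIsometricSMul Γ X] (hSfin : S.Finite) (hS : Subgroup.closure S = ⊤)
    (hμ : HasFiniteSecondMoment S μ) {f : Γ → X} (hf : IsEquivariantMap f) :
    energy μ f = ENNReal.ofReal (orbitEnergy μ (f 1)) := by
  rw [orbitEnergy, ENNReal.ofReal_tsum_of_nonneg
    (fun g => mul_nonneg (sq_nonneg _) ENNReal.toReal_nonneg)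
    (summable_orbitEnergy hSfin hS hμ (f 1))]
  refine tsum_congr fun g => ?_
  rw [hf g, ENNReal.ofReal_mul (sq_nonneg _), ENNReal.ofReal_pow dist_nonneg, ← edist_dist,
    ENNReal.ofReal_toReal (PMF.apply_ne_top _ _)]

/-- A positive function on a complete space that does not tend to zero along any convergent
sequence has points that almost minimize it on a ball of large radius relative to its value. -/
theorem exists_almost_minimizer {X : Type*} [PseudoMetricSpace X] [CompleteSpace X] [Nonempty X]
    {F : X → ℝ} (hF : ∀ y, 0 ≤ F y)
    (hlim : ∀ (u : ℕ → X) (y : X), Tendsto u atTop (𝓝 y) → ¬ Tendsto (F ∘ u) atTop (𝓝 0))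
    {q : ℝ} (hq0 : 0 ≤ q) (hq1 : q < 1) (K : ℝ) :
    ∃ y, ∀ z, dist y z ≤ K * √(F y) → q * F y ≤ F z := by
  by_contra! h
  -- Otherwise iterate φ: F shrinks by the factor q, so steps of length at most K√F are
  -- geometrically small. The iterates converge while F tends to 0.
  choose φ hφd hφF using h
  obtain ⟨y₀⟩ := ‹Nonempty X›
  set u : ℕ → X := fun k => φ^[k] y₀ with hu
  have hsucc : ∀ k, u (k + 1) = φ (u k) := fun k => Function.iterate_succ_apply' φ k y₀
  have hFu : ∀ k, F (u k) ≤ F y₀ * q ^ k := by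
    intro k
    induction k with
    | zero => simp [hu]
    | succ k ih =>
      rw [hsucc, pow_succ]
      nlinarith [hφF (u k), mul_le_mul_of_nonneg_left ih hq0]
  have hsq : √q < 1 := by rw [Real.sqrt_lt' one_pos]; simpa
  have hd : ∀ k, dist (u k) (u (k + 1)) ≤ |K| * √(F y₀) * √q ^ k := by
    intro k
    rw [hsucc]
    calc dist (u k) (φ (u k)) ≤ K * √(F (u k)) := hφd _
      _ ≤ |K| * √(F y₀ * q ^ k) :=
        mul_le_mul (le_abs_self K) (Real.sqrt_le_sqrt (hFu k)) (Real.sqrt_nonneg _) (abs_nonneg K)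
      _ = |K| * √(F y₀) * √q ^ k := by
        rw [Real.sqrt_mul (hF y₀), ← mul_assoc]
        congr 1
        rw [Real.sqrt_eq_iff_mul_self_eq (by positivity) (by positivity), ← mul_pow,
          Real.mul_self_sqrt hq0]
  obtain ⟨y, hy⟩ := cauchySeq_tendsto_of_complete (cauchySeq_of_le_geometric _ _ hsq hd)
  refine hlim u y hy (squeeze_zero (fun k => hF _) hFu ?_)
  simpa using (tendsto_pow_atTop_nhds_zero_of_lt_one hq0 hq1).const_mul (F y₀)

end Energy

/-! ### Fixed points and energy in the ultralimit -/

section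

variable {Γ : Type*} [Group Γ] {S : Set Γ} {μ : PMF Γ} {X : Type*} [MetricSpace X] [MulAction Γ X]
  [IsIsometricSMul Γ X]

/-- A group with an orbit map of arbitrarily small energy along a convergent sequence of points
fixes the limit. -/
theorem smul_eq_of_tendsto_orbitEnergy (hSfin : S.Finite) (hS : Subgroup.closure S = ⊤)
    (hμ : HasFiniteSecondMoment S μ) (hsupp : S ⊆ μ.support) {u : ℕ → X} {y : X}
    (hu : Tendsto u atTop (𝓝 y)) (hE : Tendsto (orbitEnergy μ ∘ u) atTop (𝓝 0)) (g : Γ) :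
    g • y = y := by
  obtain ⟨C, hC⟩ := exists_dist_smul_le_sqrt_orbitEnergy (X := X) hSfin hS hμ hsupp
  have h₁ : Tendsto (fun k => dist (u k) (g • u k)) atTop (𝓝 (dist y (g • y))) :=
    hu.dist (hu.const_smul g)
  have h₂ := (((Real.continuous_sqrt.tendsto 0).comp hE).const_mul C).const_mul
    (wordLength S g : ℝ)
  rw [Real.sqrt_zero, mul_zero, mul_zero] at h₂
  have h₃ : dist y (g • y) ≤ 0 := le_of_tendsto_of_tendsto' h₁ h₂ fun k => hC (u k) g
  exact (dist_le_zero.1 h₃).symm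

/-- The energy of an orbit map in an ultralimit is the limit of the rescaled energies. -/
theorem Ultralimit.tendsto_orbitEnergy {p : ℕ → X} {s : ℕ → ℝ≥0}
    [BoundedSequence.IsBoundedAction Γ p s] (hμ : HasFiniteSecondMoment S μ) {C : ℝ}
    (hC : ∀ n (g : Γ), s n * dist (p n) (g • p n) ≤ wordLength S g * C)
    (x : BoundedSequence p s) :
    Tendsto (fun n => (s n : ℝ) ^ 2 * orbitEnergy μ (x.1 n)) (hyperfilter ℕ)
      (𝓝 (orbitEnergy μ (SeparationQuotient.mk x : Ultralimit p s))) := by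
  obtain ⟨D, hD⟩ := x.2
  have hbound : ∀ n (g : Γ), s n * dist (x.1 n) (g • x.1 n) ≤ 2 * D + wordLength S g * C := by
    intro n g
    calc s n * dist (x.1 n) (g • x.1 n)
        ≤ s n * (dist (x.1 n) (p n) + dist (p n) (g • p n) + dist (g • p n) (g • x.1 n)) := by
          gcongr
          exact dist_triangle4 _ _ _ _
      _ = 2 * (s n * dist (x.1 n) (p n)) + s n * dist (p n) (g • p n) := by
          rw [dist_smul, dist_comm (p n) (x.1 n)]
          ring
      _ ≤ _ := add_le_add (mul_le_mul_of_nonneg_left (hD n) zero_le_two) (hC n g)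
  have hmul : ∀ n, (s n : ℝ) ^ 2 * orbitEnergy μ (x.1 n)
      = ∑' g : Γ, (s n : ℝ) ^ 2 * (dist (x.1 n) (g • x.1 n) ^ 2 * (μ g).toReal) := fun n =>
    tsum_mul_left.symm
  simp only [hmul]
  -- The bound is (2D + |g|C)² ≤ 8D² + 2C²|g|², summable by the second moment.
  refine tendsto_tsum_of_dominated_convergence
    (bound := fun g => 8 * D ^ 2 * (μ g).toReal
      + 2 * C ^ 2 * ((wordLength S g : ℝ) ^ 2 * (μ g).toReal))
    ((μ.summable_toReal.mul_left _).add (hμ.summable.mul_left _)) (fun g => ?_)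
    (Eventually.of_forall fun n g => ?_)
  · refine (((BoundedSequence.tendsto_dist x (g • x)).pow 2).mul_const (μ g).toReal).congr
      fun n => ?_
    rw [BoundedSequence.smul_apply]
    ring
  · rw [Real.norm_of_nonneg (by positivity), ← mul_assoc, ← mul_pow]
    have h : (s n * dist (x.1 n) (g • x.1 n)) ^ 2
        ≤ 8 * D ^ 2 + 2 * C ^ 2 * (wordLength S g : ℝ) ^ 2 := by
      have := pow_le_pow_left₀ (by positivity) (hbound n g) 2
      nlinarith [sq_nonneg (2 * D - wordLength S g * C)]
    calc (s n * dist (x.1 n) (g • x.1 n)) ^ 2 * (μ g).toReal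
        ≤ (8 * D ^ 2 + 2 * C ^ 2 * (wordLength S g : ℝ) ^ 2) * (μ g).toReal := by gcongr
      _ = _ := by ring

end

/-! ### The harmonic map -/

theorem mainTheorem6 {Γ : Type u} [Group Γ] (S : Set Γ) (hSfin : S.Finite)
    (hSgen : Subgroup.closure S = ⊤)
    (μ : PMF Γ) (hμsymm : ∀ g : Γ, μ g⁻¹ = μ g) (hμmoment : HasFiniteSecondMoment S μ)
    (hμsupp : S ⊆ μ.support)
    {Y : Type v} [MetricSpace Y] [MulAction Γ Y] [IsIsometricSMul Γ Y]
    (hY : IsFiniteDimCompleteCAT0 Y)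
    (hfix : ¬ ∃ y : Y, ∀ g : Γ, g • y = y) :
    ∃ (Z : Type v) (_ : MetricSpace Z) (_ : MulAction Γ Z),
      IsFiniteDimCompleteCAT0 Z ∧ IsIsometricSMul Γ Z ∧
        ∃ h : Γ → Z, IsHarmonicEquivariantMap μ h ∧ 0 < energy μ h ∧ energy μ h < ∞ := by
  have := hY.complete
  have := hY.isCAT0.nonempty
  set F : Y → ℝ := orbitEnergy μ with hF
  have hlim : ∀ (u : ℕ → Y) (y : Y), Tendsto u atTop (𝓝 y) → ¬ Tendsto (F ∘ u) atTop (𝓝 0) :=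
    fun u y hu hE => hfix ⟨y, smul_eq_of_tendsto_orbitEnergy hSfin hSgen hμmoment hμsupp hu hE⟩
  have hpos : ∀ y, 0 < F y := fun y => (orbitEnergy_nonneg y).lt_of_ne fun h =>
    hlim (fun _ => y) y tendsto_const_nhds
      ((tendsto_const_nhds (x := (0 : ℝ))).congr fun _ => h)
  have hq : ∀ n : ℕ, 0 ≤ 1 - 1 / ((n : ℝ) + 1) ∧ 1 - 1 / ((n : ℝ) + 1) < 1 := fun n =>
    ⟨by rw [sub_nonneg, div_le_one (by positivity)]; linarith [n.cast_nonneg (α := ℝ)],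
      sub_lt_self _ (by positivity)⟩
  -- The radius factor n tends to infinity and the ratio 1 - 1/(n+1) to 1.
  choose p hp using fun n : ℕ =>
    exists_almost_minimizer (fun y => (hpos y).le) hlim (hq n).1 (hq n).2 n
  set s : ℕ → ℝ≥0 := fun n => ⟨(√(F (p n)))⁻¹, by positivity⟩ with hs
  have hsF : ∀ n, (s n : ℝ) * √(F (p n)) = 1 := fun n =>
    inv_mul_cancel₀ (Real.sqrt_pos.2 (hpos _)).ne'
  have hsF2 : ∀ n, (s n : ℝ) ^ 2 * F (p n) = 1 := fun n => by
    conv_lhs => rw [← Real.sq_sqrt (hpos (p n)).le]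
    rw [← mul_pow, hsF, one_pow]
  obtain ⟨C, hC⟩ :=
    exists_dist_smul_le_sqrt_orbitEnergy (X := Y) hSfin hSgen hμmoment hμsupp
  have hC' : ∀ n (g : Γ), s n * dist (p n) (g • p n) ≤ wordLength S g * C := fun n g =>
    calc s n * dist (p n) (g • p n) ≤ s n * (wordLength S g * (C * √(F (p n)))) :=
          mul_le_mul_of_nonneg_left (hC _ g) (s n).2
      _ = wordLength S g * C * (s n * √(F (p n))) := by ring
      _ = wordLength S g * C := by rw [hsF, mul_one]
  have : BoundedSequence.IsBoundedAction Γ p s :=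
    ⟨fun g => ⟨_, fun n => (dist_comm (g • p n) (p n) ▸ hC' n g)⟩⟩
  have hE := Ultralimit.tendsto_orbitEnergy (p := p) (s := s) hμmoment hC'
  have hE1 : orbitEnergy μ
      (SeparationQuotient.mk (Ultralimit.base p s) : Ultralimit p s) = 1 := by
    refine tendsto_nhds_unique (hE _) (tendsto_const_nhds.congr fun n => (hsF2 n).symm)
  have hmin : ∀ z : Ultralimit p s, 1 ≤ orbitEnergy μ z := by
    refine SeparationQuotient.surjective_mk.forall.2 fun x => ?_
    have h1 : Tendsto (fun n : ℕ => 1 - 1 / ((n : ℝ) + 1)) (hyperfilter ℕ) (𝓝 1) := by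
      have h := (tendsto_one_div_add_atTop_nhds_zero_nat (𝕜 := ℝ)).const_sub 1
      rw [sub_zero] at h
      exact h.mono_left Nat.hyperfilter_le_atTop
    refine le_of_tendsto_of_tendsto h1 (hE x) ?_
    obtain ⟨D, hD⟩ := x.2
    -- Once n ≥ D, `x.1 n` lies in the ball where `p n` almost minimizes F.
    filter_upwards [Nat.hyperfilter_le_atTop (eventually_ge_atTop ⌈D⌉₊)] with n hn
    have hdist : dist (p n) (x.1 n) ≤ n * √(F (p n)) := by
      calc dist (p n) (x.1 n) = (s n * dist (x.1 n) (p n)) * √(F (p n)) := by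
            rw [mul_right_comm, hsF, one_mul, dist_comm]
        _ ≤ n * √(F (p n)) := by
            gcongr
            exact (hD n).trans (Nat.ceil_le.1 hn)
    calc 1 - 1 / ((n : ℝ) + 1) = (s n : ℝ) ^ 2 * ((1 - 1 / ((n : ℝ) + 1)) * F (p n)) := by
          rw [mul_left_comm, hsF2, mul_one]
      _ ≤ (s n : ℝ) ^ 2 * F (x.1 n) :=
          mul_le_mul_of_nonneg_left (hp n _ hdist) (sq_nonneg _)
  set z : Ultralimit p s := SeparationQuotient.mk (Ultralimit.base p s) with hz
  have heq : IsEquivariantMap fun g : Γ => g • z := fun g => by simp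
  have hEz : energy μ (fun g : Γ => g • z) = 1 := by
    rw [energy_eq_ofReal_orbitEnergy hSfin hSgen hμmoment heq, one_smul, hE1, ENNReal.ofReal_one]
  refine ⟨Ultralimit p s, inferInstance, inferInstance, Ultralimit.isFiniteDimCompleteCAT0 hY,
    inferInstance, fun g => g • z, ⟨heq, fun f hf => ?_⟩, ?_, ?_⟩
  · rw [hEz, energy_eq_ofReal_orbitEnergy hSfin hSgen hμmoment hf, ENNReal.one_le_ofReal]
    exact hmin _
  · rw [hEz]
    exact one_pos
  · rw [hEz]
    exact ENNReal.one_lt_top
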